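/- Let $\mathcal H$ be a finite-dimensional complex Hilbert space and let $\mathcal L$ and $\mathcal D$ be GKLS generators on the space $B(\mathcal H)$ of linear operators on $\mathcal H$, i.e. linear maps of the form $\rho\mapsto -\mathrm i[K,\rho]+\sum_{j=1}^m\bigl(J_j\rho J_j^\dagger-\tfrac12(J_j^\dagger J_j\rho+\rho J_j^\dagger J_j)\bigr)$ with $K=K^\dagger$ and $J_1,\dots,J_m\in B(\mathcal H)$. Let $\mathcal P_\varphi$ be the peripheral projection of $\mathcal D$, i.e. the sum, over the purely imaginary eigenvalues $\alpha\in\mathrm i\mathbb R$ of $\mathcal D$ (including $0$), of the spectral projections of $\mathcal D$, where the spectral projection at $\alpha$ is the projection onto the generalized eigenspace at $\alpha$ along the sum of the other generalized eigenspaces. Suppose that $\mathcal D$ has no persistent oscillations in the long-time limit: $$\lim_{t\to+\infty}\mathrm e^{t\mathcal D}=\mathcal P_\varphi .$$ Put $\mathcal L_Z=\mathcal P_\varphi\mathcal L\mathcal P_\varphi$. Then $$\mathrm e^{t(\gamma\mathcal D+\mathcal L)}=\mathrm e^{t\mathcal L_Z}\mathcal P_\varphi+\mathcal O(1/\gamma)\qquad\text{as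 }\gamma\to+\infty,$$ uniformly in $t$ on compact intervals of $(0,+\infty)$; that is, for all $0<t_1\le t_2$ there are constants $C\in\mathbb R$ and $\gamma_0>0$ such that $\|\mathrm e^{t(\gamma\mathcal D+\mathcal L)}-\mathrm e^{t\mathcal L_Z}\mathcal P_\varphi\|\le C/\gamma$ for all $\gamma\ge\gamma_0$ and all $t\in[t_1,t_2]$. -/

import Mathlib

open Filter Topology

/-- Linear operators on the Hilbert space `H`, with the operator norm. -/
abbrev Op (H : Type*) [NormedAddCommGroup H] [InnerProductSpace ℂ H] : Type _ :=
  H →L[ℂ] H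

/-- Superoperators: linear maps on the space of operators on `H`, with the operator norm.
The product `*` is composition. -/
abbrev Superop (H : Type*) [NormedAddCommGroup H] [InnerProductSpace ℂ H] : Type _ :=
  Op H →L[ℂ] Op H

/-- `L` is a GKLS (Gorini-Kossakowski-Lindblad-Sudarshan) generator:
`L ρ = -i [K, ρ] + ∑ⱼ (Jⱼ ρ Jⱼ† - ½ (Jⱼ† Jⱼ ρ + ρ Jⱼ† Jⱼ))`
for some Hermitian `K` and finitely many operators `Jⱼ`. -/
def IsGKLSGenerator {H : Type*} [NormedAddCommGroup H] [InnerProductSpace ℂ H] [CompleteSpace H]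
    (L : Superop H) : Prop :=
  ∃ (K : Op H) (m : ℕ) (J : Fin m → Op H), IsSelfAdjoint K ∧
    ∀ ρ : Op H, L ρ = -(Complex.I • (K * ρ - ρ * K)) +
      ∑ j : Fin m, (J j * ρ * star (J j) -
        (1 / 2 : ℂ) • (star (J j) * J j * ρ + ρ * (star (J j) * J j)))

theorem isCompl_maxGenEigenspace {V : Type*} [AddCommGroup V] [Module ℂ V]
    [FiniteDimensional ℂ V] (A : Module.End ℂ V) (a : ℂ) :
    IsCompl (A.maxGenEigenspace a) (⨆ b : ℂ, ⨆ _ : b ≠ a, A.maxGenEigenspace b) := by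
  refine ⟨A.independent_maxGenEigenspace a, ?_⟩
  rw [codisjoint_iff, eq_top_iff, ← Module.End.iSup_maxGenEigenspace_eq_top A]
  refine iSup_le fun b => ?_
  by_cases h : b = a
  · subst h
    exact le_sup_left
  · exact le_sup_of_le_right
      (le_iSup₂ (f := fun (c : ℂ) (_ : c ≠ a) => A.maxGenEigenspace c) b h)

/-- The spectral projection (eigenprojection) of `A` at `a`: the projection onto the generalized
eigenspace of `A` at `a` along the sum of all the other generalized eigenspaces. -/
noncomputable def spectralProjection {V : Type*} [AddCommGroup V] [Module ℂ V]
    [FiniteDimensional ℂ V] (A : Module.End ℂ V) (a : ℂ) : Module.End ℂ V :=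
  Submodule.projection _ _ (isCompl_maxGenEigenspace A a)

open scoped Classical in
/-- The peripheral projection of `D`: the sum of the spectral projections of `D` over its purely
imaginary eigenvalues (including the eigenvalue `0`). -/
noncomputable def peripheralProjection {V : Type*} [NormedAddCommGroup V] [NormedSpace ℂ V]
    [FiniteDimensional ℂ V] (D : V →L[ℂ] V) : V →L[ℂ] V :=
  LinearMap.toContinuousLinearMap
    (∑ a ∈ (Module.End.finite_hasEigenvalue (D : Module.End ℂ V)).toFinset with a.re = 0,
      spectralProjection (D : Module.End ℂ V) a)

/-- The Zeno projection `P L P` of the superoperator `L` by `P`. -/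
noncomputable def zenoProjection {H : Type*} [NormedAddCommGroup H] [InnerProductSpace ℂ H]
    (P L : Superop H) : Superop H :=
  P * L * P

section StrongDamping

open NormedSpace Set

variable {A : Type*} [NormedRing A] [NormedAlgebra ℝ A] [CompleteSpace A]

/-! Convergence of `exp (t • D)` to `P` forces `P * P = P`, `D * P = 0` and exponential decay on the
range of `1 - P`. Split the full semigroup along `1 - P` and `P`. On `1 - P`, Duhamel's formula
against `γ • D` leaves a transient of rate `γ * η`, plus `O(1/γ)`; this needs a bound on the full
semigroup uniform in `γ`. On `P`, Duhamel's formula against `P * L * P` has a source in the range of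
`1 - P`, because `D * P = 0`. The full semigroup damps that source, and the integrated transient is
again `O(1/γ)`. -/

theorem exp_add_smul (X : A) (s t : ℝ) : exp ((s + t) • X) = exp (s • X) * exp (t • X) := by
  let : NormedAlgebra ℚ A := .restrictScalars ℚ ℝ A
  rw [add_smul, exp_add_of_commute (((Commute.refl X).smul_left s).smul_right t)]

theorem continuous_exp_smul (X : A) : Continuous fun t : ℝ => exp (t • X) :=
  continuous_iff_continuousAt.2 fun t => (hasDerivAt_exp_smul_const (𝕂 := ℝ) X t).continuousAt

theorem exists_norm_exp_smul_le_on_Icc (X : A) (T : ℝ) :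
    ∃ M : ℝ, 0 < M ∧ ∀ t ∈ Icc (0 : ℝ) T, ‖exp (t • X)‖ ≤ M := by
  obtain ⟨M, hM⟩ := isCompact_Icc.exists_bound_of_continuousOn
    (continuous_exp_smul X).continuousOn (s := Icc (0 : ℝ) T)
  exact ⟨max M 1, by positivity, fun t ht => (hM t ht).trans (le_max_left _ _)⟩

/-- Duhamel's formula as an estimate: a primitive of a bound on the integrand bounds the
difference of the two semigroups. -/
theorem norm_exp_smul_sub_exp_smul_mul_le (X Y R : A) {t : ℝ} (ht : 0 ≤ t) {b b' : ℝ → ℝ}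
    (hb : ∀ s, HasDerivAt b (b' s) s)
    (h : ∀ s ∈ Ico 0 t, ‖exp ((t - s) • X) * ((Y - X) * exp (s • Y) * R)‖ ≤ b' s) :
    ‖(exp (t • Y) - exp (t • X)) * R‖ ≤ b t - b 0 := by
  have hd : ∀ s : ℝ, HasDerivAt (fun s : ℝ => exp ((t - s) • X) * exp (s • Y) * R
      - exp (t • X) * R) (exp ((t - s) • X) * ((Y - X) * exp (s • Y) * R)) s := by
    intro s
    have h1 : HasDerivAt (fun s : ℝ => exp ((t - s) • X)) ((-1 : ℝ) • (exp ((t - s) • X) * X)) s :=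
      (hasDerivAt_exp_smul_const (𝕂 := ℝ) X (t - s)).scomp s ((hasDerivAt_id s).const_sub t)
    have h2 := hasDerivAt_exp_smul_const' (𝕂 := ℝ) Y s
    refine (((h1.mul h2).mul_const R).sub_const _).congr_deriv ?_
    simp only [neg_smul, one_smul]
    noncomm_ring
  have := image_norm_le_of_norm_deriv_right_le_deriv_boundary (a := 0) (b := t)
    (B := fun s => b s - b 0)
    (fun s _ => (hd s).continuousAt.continuousWithinAt) (fun s _ => (hd s).hasDerivWithinAt)
    (by simp [NormedSpace.exp_zero]) (fun s => (hb s).sub_const _) h (right_mem_Icc.2 ht)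
  simpa [NormedSpace.exp_zero, sub_mul] using this

theorem exists_norm_exp_smul_le_of_tendsto {D P : A}
    (h : Tendsto (fun t : ℝ => exp (t • D)) atTop (𝓝 P)) :
    ∃ M : ℝ, 0 < M ∧ ∀ t : ℝ, 0 ≤ t → ‖exp (t • D)‖ ≤ M := by
  obtain ⟨T, hT⟩ := eventually_atTop.1 (h.norm.eventually (gt_mem_nhds (lt_add_one ‖P‖)))
  obtain ⟨M, hM0, hM⟩ := exists_norm_exp_smul_le_on_Icc D T
  refine ⟨max M (‖P‖ + 1), lt_max_of_lt_left hM0, fun t ht => ?_⟩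
  rcases le_total t T with h1 | h1
  · exact (hM t ⟨ht, h1⟩).trans (le_max_left _ _)
  · exact (hT t h1).le.trans (le_max_right _ _)

/-! ### Algebra and convergence rate of the limit. -/

section Limit

variable {D P : A} (h : Tendsto (fun t : ℝ => exp (t • D)) atTop (𝓝 P))
include h

theorem exp_smul_mul_limit (s : ℝ) : exp (s • D) * P = P := by
  refine tendsto_nhds_unique (h.const_mul (exp (s • D))) ?_
  refine (h.comp (tendsto_atTop_add_const_left atTop s tendsto_id)).congr fun t => ?_
  simp [exp_add_smul]

theorem limit_mul_exp_smul (s : ℝ) : P * exp (s • D) = P := by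
  refine tendsto_nhds_unique (h.mul_const (exp (s • D))) ?_
  refine (h.comp (tendsto_atTop_add_const_right atTop s tendsto_id)).congr fun t => ?_
  simp [exp_add_smul]

theorem limit_mul_self : P * P = P :=
  tendsto_nhds_unique (h.mul_const P)
    (tendsto_const_nhds.congr fun s => (exp_smul_mul_limit h s).symm)

/-- `exp (s • D) * P` is constant in `s`; its derivative at `0` is `D * P`. -/
theorem mul_limit_eq_zero : D * P = 0 := by
  have h1 := (hasDerivAt_exp_smul_const' (𝕂 := ℝ) D 0).mul_const P
  simp only [exp_smul_mul_limit h, mul_assoc] at h1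
  exact h1.unique (hasDerivAt_const 0 P)

/-- If `exp (t • D)` converges, then it does so exponentially fast. -/
theorem exists_norm_exp_smul_mul_one_sub_le :
    ∃ N η : ℝ, 0 < N ∧ 0 < η ∧
      ∀ t : ℝ, 0 ≤ t → ‖exp (t • D) * (1 - P)‖ ≤ N * Real.exp (-(η * t)) := by
  obtain ⟨M, hM0, hM⟩ := exists_norm_exp_smul_le_of_tendsto h
  have h0 : Tendsto (fun t : ℝ => ‖exp (t • D) * (1 - P)‖) atTop (𝓝 0) := by
    have := (h.mul_const (1 - P)).norm
    simpa [mul_sub, limit_mul_self h] using this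
  -- One time `a` of contraction by `exp (-1)` suffices: iterating it gives rate `a⁻¹`.
  obtain ⟨a, ha, ha0⟩ := ((h0.eventually (gt_mem_nhds (Real.exp_pos (-1)))).and
    (eventually_gt_atTop 0)).exists
  have hQ : ∀ s : ℝ, (1 - P) * (exp (s • D) * (1 - P)) = exp (s • D) * (1 - P) := by
    intro s
    have : P * (exp (s • D) * (1 - P)) = 0 := by
      rw [← mul_assoc, limit_mul_exp_smul h, mul_sub, mul_one, limit_mul_self h, sub_self]
    rw [sub_mul, one_mul, this, sub_zero]
  have hn : ∀ n : ℕ, ‖exp ((n * a) • D) * (1 - P)‖ ≤ ‖1 - P‖ * Real.exp (-n) := by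
    intro n
    induction n with
    | zero => simp [NormedSpace.exp_zero]
    | succ n ih =>
      have e : exp (((n + 1 : ℕ) * a) • D) * (1 - P)
          = (exp (a • D) * (1 - P)) * (exp ((n * a) • D) * (1 - P)) := by
        rw [mul_assoc, hQ, ← mul_assoc, ← exp_add_smul]
        congr 3
        push_cast
        ring
      calc _ ≤ Real.exp (-1) * (‖1 - P‖ * Real.exp (-n)) := by
            rw [e]
            exact (norm_mul_le _ _).trans (mul_le_mul ha.le ih (norm_nonneg _) (Real.exp_pos _).le)
        _ = _ := by
            rw [mul_left_comm, ← Real.exp_add]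
            congr 2
            push_cast
            ring
  -- Rounding `t / a` down costs at most a factor `e`; the `+ 1` keeps the constant positive when `P
  -- = 1`.
  refine ⟨M * (‖1 - P‖ + 1) * Real.exp 1, a⁻¹, by positivity, by positivity, fun t ht => ?_⟩
  have h1 : ⌊t / a⌋₊ * a ≤ t := (le_div_iff₀ ha0).1 (Nat.floor_le (by positivity))
  have h2 : t / a < ⌊t / a⌋₊ + 1 := Nat.lt_floor_add_one _
  have e : exp (t • D) * (1 - P)
      = exp ((t - ⌊t / a⌋₊ * a) • D) * (exp ((⌊t / a⌋₊ * a) • D) * (1 - P)) := by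
    rw [← mul_assoc, ← exp_add_smul, sub_add_cancel]
  calc _ ≤ M * (‖1 - P‖ * Real.exp (-⌊t / a⌋₊)) := by
        rw [e]
        exact (norm_mul_le _ _).trans
          (mul_le_mul (hM _ (sub_nonneg.2 h1)) (hn _) (norm_nonneg _) hM0.le)
    _ ≤ M * ((‖1 - P‖ + 1) * (Real.exp 1 * Real.exp (-(a⁻¹ * t)))) := by
        rw [← Real.exp_add]
        gcongr
        · linarith
        · rw [div_eq_inv_mul] at h2
          rw [div_eq_inv_mul]
          linarith
    _ = _ := by ring

end Limit

/-- A bounded perturbation of a bounded semigroup is bounded on compact time intervals, uniformly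
in a rescaling of the unperturbed generator. -/
theorem exists_norm_exp_smul_add_le (D L : A) {M : ℝ} (hM0 : 0 < M)
    (hM : ∀ t : ℝ, 0 ≤ t → ‖exp (t • D)‖ ≤ M) (T : ℝ) (hT : 0 ≤ T) :
    ∃ B : ℝ, 0 < B ∧ ∀ γ : ℝ, 0 ≤ γ → ∀ t ∈ Icc 0 T, ‖exp (t • (γ • D + L))‖ ≤ B := by
  have short : ∀ γ : ℝ, 0 ≤ γ → ∀ τ : ℝ, 0 ≤ τ → M * ‖L‖ * τ ≤ 1 / 2 →
      ∀ t ∈ Icc 0 τ, ‖exp (t • (γ • D + L))‖ ≤ 2 * M := by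
    intro γ hγ τ hτ hs
    -- At a maximiser of the norm, Duhamel gives `K ≤ M + K / 2`, with no dependence on `γ`.
    obtain ⟨u, hu, hmax⟩ := isCompact_Icc.exists_isMaxOn (nonempty_Icc.2 hτ)
      (continuous_exp_smul (γ • D + L)).norm.continuousOn
    set K := ‖exp (u • (γ • D + L))‖ with hK
    have hK0 : 0 ≤ K := norm_nonneg _
    have hγD : ∀ s : ℝ, 0 ≤ s → ‖exp (s • (γ • D))‖ ≤ M := fun s hs => by
      rw [smul_smul]; exact hM _ (by positivity)
    have key := norm_exp_smul_sub_exp_smul_mul_le (γ • D) (γ • D + L) 1 hu.1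
      (b := fun s => (M * (‖L‖ * K)) * s) (b' := fun _ => M * (‖L‖ * K))
      (fun s => by simpa using (hasDerivAt_id s).const_mul (M * (‖L‖ * K)))
      (fun s hs => by
        rw [mul_one, add_sub_cancel_left]
        refine (norm_mul_le _ _).trans (mul_le_mul (hγD _ (sub_nonneg.2 hs.2.le))
          ((norm_mul_le _ _).trans ?_) (norm_nonneg _) hM0.le)
        gcongr
        exact hmax ⟨hs.1, hs.2.le.trans hu.2⟩)
    rw [mul_one, mul_zero, sub_zero] at key
    have h1 : K ≤ M * (‖L‖ * K) * u + M := by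
      have h2 := norm_sub_norm_le (exp (u • (γ • D + L))) (exp (u • (γ • D)))
      linarith [hγD u hu.1]
    have h3 : M * (‖L‖ * K) * u ≤ 1 / 2 * K :=
      calc _ = M * ‖L‖ * u * K := by ring
        _ ≤ M * ‖L‖ * τ * K := by gcongr; exact hu.2
        _ ≤ _ := by gcongr
    intro t ht
    exact (show _ ≤ K from hmax ht).trans (by linarith)
  obtain ⟨n, hn⟩ := exists_nat_gt (2 * (M * ‖L‖ * T))
  have hn0 : (0 : ℝ) < n := lt_of_le_of_lt (by positivity) hn
  have hτ : M * ‖L‖ * (T / n) ≤ 1 / 2 := by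
    rw [← mul_div_assoc, div_le_iff₀ hn0]
    linarith
  refine ⟨(2 * M) ^ n, by positivity, fun γ hγ t ht => ?_⟩
  have e : exp (t • (γ • D + L)) = exp ((t / n) • (γ • D + L)) ^ n := by
    let : NormedAlgebra ℚ A := .restrictScalars ℚ ℝ A
    rw [← exp_nsmul, ← Nat.cast_smul_eq_nsmul ℝ, smul_smul, mul_div_cancel₀ _ hn0.ne']
  rw [e]
  refine (norm_pow_le' _ (by exact_mod_cast hn0)).trans (pow_le_pow_left₀ (norm_nonneg _) ?_ n)
  exact short γ hγ (T / n) (by positivity) hτ _ ⟨by have := ht.1; positivity, by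
    gcongr; exact ht.2⟩

/-- The shift `d` also covers kernels in `t - s`. -/
theorem hasDerivAt_mul_exp_div {c : ℝ} (hc : c ≠ 0) (N d s : ℝ) :
    HasDerivAt (fun s => N / c * Real.exp (c * s + d)) (N * Real.exp (c * s + d)) s := by
  have := ((((hasDerivAt_id s).const_mul c).add_const d).exp).const_mul (N / c)
  refine this.congr_deriv ?_
  simp only [id]
  field_simp

/-- Strong-damping limit: if `exp (t • D)` converges to `P` then the semigroup generated by
`γ • D + L` is approximated, up to `O(1/γ)`, by the projected dynamics. -/
theorem norm_exp_smul_add_sub_le {D P : A}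
    (h : Tendsto (fun t : ℝ => exp (t • D)) atTop (𝓝 P)) (L : A) {t₁ t₂ : ℝ} (ht₁ : 0 < t₁)
    (ht₂ : t₁ ≤ t₂) :
    ∃ C : ℝ, ∀ γ : ℝ, 0 < γ → ∀ t ∈ Icc t₁ t₂,
      ‖exp (t • (γ • D + L)) - exp (t • (P * L * P)) * P‖ ≤ C / γ := by
  obtain ⟨M, hM0, hM⟩ := exists_norm_exp_smul_le_of_tendsto h
  obtain ⟨N, η, hN, hη, hdec⟩ := exists_norm_exp_smul_mul_one_sub_le h
  obtain ⟨B, hB0, hB⟩ := exists_norm_exp_smul_add_le D L hM0 hM t₂ (ht₁.le.trans ht₂)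
  obtain ⟨E, hE0, hE⟩ := exists_norm_exp_smul_le_on_Icc (P * L * P) t₂
  have hPP := limit_mul_self h
  have hDP := mul_limit_eq_zero h
  set c₁ := B * (‖L‖ * N) / η with hc₁
  have hc₁0 : 0 ≤ c₁ := by positivity
  have hdecay : ∀ γ : ℝ, 0 < γ → ∀ t ∈ Icc 0 t₂,
      ‖exp (t • (γ • D + L)) * (1 - P)‖ ≤ N * Real.exp (-(γ * η) * t) + c₁ / γ := by
    intro γ hγ t ht
    have hγD : ∀ s : ℝ, 0 ≤ s →
        ‖exp (s • (γ • D)) * (1 - P)‖ ≤ N * Real.exp (-(γ * η) * s + 0) := fun s hs => by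
      rw [smul_smul]
      refine (hdec _ (by positivity)).trans_eq ?_
      congr 2
      ring
    have hc : -(γ * η) ≠ 0 := by have := mul_pos hγ hη; linarith
    -- The full semigroup is the outer factor here, so that `1 - P` stays next to the decaying `exp
    -- (s • (γ • D))`.
    have key := norm_exp_smul_sub_exp_smul_mul_le (γ • D + L) (γ • D) (1 - P) ht.1
      (hasDerivAt_mul_exp_div hc (B * (‖L‖ * N)) 0) (fun s hs => by
        rw [mul_assoc, mul_assoc B, mul_assoc ‖L‖]
        refine (norm_mul_le _ _).trans (mul_le_mul (hB γ hγ.le _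
          ⟨sub_nonneg.2 hs.2.le, by linarith [hs.1, ht.2]⟩) ((norm_mul_le _ _).trans ?_)
          (norm_nonneg _) hB0.le)
        rw [sub_add_cancel_left, norm_neg]
        gcongr
        exact hγD s hs.1)
    have e : B * (‖L‖ * N) / -(γ * η) = -(c₁ / γ) := by
      rw [hc₁]; field_simp
    rw [e] at key
    have h1 := norm_sub_norm_le (exp (t • (γ • D + L)) * (1 - P)) (exp (t • (γ • D)) * (1 - P))
    rw [norm_sub_rev, ← sub_mul] at h1
    have h2 : 0 ≤ c₁ / γ * Real.exp (-(γ * η) * t + 0) := by positivity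
    have h3 := hγD t ht.1
    rw [add_zero] at h3
    simp only [mul_zero, add_zero, Real.exp_zero, mul_one] at key h2
    linarith
  refine ⟨N / (η * t₁) + c₁ + (N / η + c₁ * t₂) * (‖L * P‖ * E), fun γ hγ t ht => ?_⟩
  have ht0 : 0 < t := ht₁.trans_le ht.1
  have hfast : ‖exp (t • (γ • D + L)) * (1 - P)‖ ≤ N / (η * t₁) / γ + c₁ / γ := by
    refine (hdecay γ hγ t ⟨ht0.le, ht.2⟩).trans ?_
    have hx : 0 < γ * η * t₁ := by positivity
    -- Away from `t = 0` the transient is `O(1/γ)`, by `exp (-x) ≤ 1 / x`.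
    have : Real.exp (-(γ * η) * t) ≤ (γ * η * t₁)⁻¹ := by
      calc _ ≤ Real.exp (-(γ * η * t₁)) := by
            gcongr
            rw [neg_mul]
            gcongr
            exact ht.1
        _ ≤ _ := by
            rw [Real.exp_neg]
            gcongr
            linarith [Real.add_one_le_exp (γ * η * t₁)]
    calc _ ≤ N * (γ * η * t₁)⁻¹ + c₁ / γ := by gcongr
      _ = _ := by field_simp
  have hslow : ‖(exp (t • (P * L * P)) - exp (t • (γ • D + L))) * P‖
      ≤ (N / η + c₁ * t₂) * (‖L * P‖ * E) / γ := by
    have hcomm : ∀ s : ℝ, exp (s • (P * L * P)) * P = P * exp (s • (P * L * P)) := by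
      intro s
      have : Commute (P * L * P) P := by
        rw [Commute, SemiconjBy, mul_assoc, hPP, ← mul_assoc P, ← mul_assoc P, hPP]
      exact ((this.smul_left s).exp_left).eq
    have hγη : γ * η ≠ 0 := by positivity
    set w := ‖L * P‖ * E with hw
    have hw0 : 0 ≤ w := by positivity
    have key := norm_exp_smul_sub_exp_smul_mul_le (γ • D + L) (P * L * P) P ht0.le
      (fun s => (hasDerivAt_mul_exp_div hγη (N * w) (-(γ * η) * t) s).add
        ((hasDerivAt_id s).const_mul (c₁ / γ * w)))
      (fun s hs => by
        -- Moving `P` leftwards past the exponential kills `γ • D`, and `P * L * P - L * P = -(1 -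
        -- P) * L * P`.
        have e : (P * L * P - (γ • D + L)) * exp (s • (P * L * P)) * P
            = -((1 - P) * (L * P * exp (s • (P * L * P)))) := by
          rw [mul_assoc, hcomm, ← mul_assoc, sub_mul, add_mul, smul_mul_assoc, hDP, smul_zero,
            zero_add, mul_assoc _ P P, hPP]
          noncomm_ring
        rw [e, mul_neg, norm_neg, ← mul_assoc]
        refine (norm_mul_le _ _).trans ((mul_le_mul (hdecay γ hγ (t - s)
          ⟨sub_nonneg.2 hs.2.le, by linarith [hs.1, ht.2]⟩)
          ((norm_mul_le _ _).trans (mul_le_mul_of_nonneg_left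
            (hE s ⟨hs.1, hs.2.le.trans ht.2⟩) (norm_nonneg _))) (norm_nonneg _)
            (by positivity)).trans_eq ?_)
        rw [show -(γ * η) * (t - s) = γ * η * s + -(γ * η) * t by ring]
        ring)
    refine key.trans ?_
    have h1 : 0 ≤ N * w / (γ * η) * Real.exp (γ * η * 0 + -(γ * η) * t) := by positivity
    have h2 : c₁ / γ * w * t ≤ c₁ / γ * w * t₂ := by gcongr; exact ht.2
    have h3 : Real.exp (γ * η * t + -(γ * η) * t) = 1 := by
      rw [← Real.exp_zero]; congr 1; ring
    have h4 : (N / η + c₁ * t₂) * w / γ = N * w / (γ * η) + c₁ / γ * w * t₂ := by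
      field_simp
    simp only [Pi.add_apply, id, h3, h4, mul_one] at h1 ⊢
    linarith
  have e : exp (t • (γ • D + L)) - exp (t • (P * L * P)) * P
      = exp (t • (γ • D + L)) * (1 - P)
        - (exp (t • (P * L * P)) - exp (t • (γ • D + L))) * P := by noncomm_ring
  rw [e, add_div, add_div]
  exact (norm_sub_le _ _).trans (add_le_add hfast hslow)

end StrongDamping

theorem corollary1 {H : Type*} [NormedAddCommGroup H] [InnerProductSpace ℂ H] [CompleteSpace H]
    [FiniteDimensional ℂ H] (L D : Superop H)
    (hL : IsGKLSGenerator L) (hD : IsGKLSGenerator D)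
    (hlim : Tendsto (fun t : ℝ => NormedSpace.exp (t • D)) atTop (𝓝 (peripheralProjection D)))
    (t₁ t₂ : ℝ) (ht₁ : 0 < t₁) (ht₂ : t₁ ≤ t₂) :
    ∃ C γ₀ : ℝ, 0 < γ₀ ∧ ∀ γ : ℝ, γ₀ ≤ γ → ∀ t ∈ Set.Icc t₁ t₂,
      ‖NormedSpace.exp (t • (γ • D + L)) -
        NormedSpace.exp (t • zenoProjection (peripheralProjection D) L) * peripheralProjection D‖
        ≤ C / γ := by

  obtain ⟨C, hC⟩ := norm_exp_smul_add_sub_le hlim L ht₁ ht₂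
  exact ⟨C, 1, one_pos, fun γ hγ => hC γ (one_pos.trans_le hγ)⟩
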